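/- Let $P$ be a finite group satisfying the following four conditions: (S1) for all $a_1,a_2\in P$ there are $x,y\in P$ with $a_2=x^{-1}a_1^{-1}yxy^{-1}$; (S2) for all $a_1,a_2,a_3\in P$ there are $u,v\in P$ with $a_2=a_3ua_1^{-1}a_3^{-1}vu^{-1}v^{-1}$; (S3) for all non-trivial $u_1,u_2,u_3,u_4\in P$ there are $x,y,z\in P$ with $u_4=x^{-1}u_1x\,y^{-1}u_2y\,z^{-1}u_3z$; (S4) there are non-trivial $u_1,u_2,u_3\in P$ such that $u_3\neq x^{-1}u_2^{-1}x\,y^{-1}u_1^{-1}y$ for all $x,y\in P$. Let $H=\bigoplus_{i\in\mathbb Z}H_i$ be the group of finitely supported families indexed by $\mathbb Z$ in $P$ (each $H_i$ a copy of $P$), let $\alpha\in\mathrm{Aut}(H)$ be the shift $\alpha((h_i)_{i})=(h_{i+1})_{i}$, let $G_{\mathbb Z}=H\rtimes\mathbb Z$ with $k\in\mathbb Z$ acting by $\alpha^k$, and let $t=(1_H,1)$ and $S=H_0\cup\{t,t^{-1}\}$. For $g\in G_{\mathbb Z}$ let $\|g\|$ be the least $k$ such that $g$ is a product of $k$ conjugates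 of elements of $S$. An invariant pseudo-norm on a group $C$ is a function $\ell:C\to[0,\infty)$ with $\ell(1)=0$, $\ell(g^{-1})=\ell(g)$, $\ell(gh)\le\ell(g)+\ell(h)$ and $\ell(h^{-1}gh)=\ell(g)$ for all $g,h\in C$; it is a norm if moreover $\ell(g)=0$ only for $g=1$. A group $G$ with an invariant pseudo-norm $\ell$ is called metrically LEF if for every finite $D\subseteq G$ and every finite set $Q$ of non-negative rationals with $0\in Q$ there are a finite group $C$ with an invariant pseudo-norm $\ell_C$ and an injective map $\varphi:D\to C$ such that $\varphi(hg)=\varphi(h)\varphi(g)$ whenever $h,g,hg\in D$, and such that for all $g\in D$, $q\in Q$ and $\square\in\{<,>,=\}$ one has $\ell(g)\,\square\,q\Leftrightarrow\ell_C(\varphi(g))\,\square\,q$. Then $G_{\mathbb Z}$ is finitely generated (and is generated by $S$), $\|\cdot\|$ is a conjugation-invariant norm on $G_{\mathbb Z}$, and $(G_{\mathbb Z},\|\cdot\|)$ is metrically LEF. In particular the same holds for the group $G_2$ obtained in this way from $P=A_5$, the alternating group of degree $5$ (the restricted wreath product $A_5\wr\mathbb Z$), which is not residually finite. -/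

import Mathlib

open scoped NNReal

namespace MetricLEF

/-! Pseudo-normed groups. The value set is `[0, ∞)`. -/

/-- An invariant pseudo-norm on a group. -/
structure IsInvariantPseudoNorm {G : Type*} [Group G] (l : G → ℝ≥0) : Prop where
  map_one : l 1 = 0
  map_inv : ∀ g, l g = l g⁻¹
  map_mul_le : ∀ g h, l (g * h) ≤ l g + l h
  map_conj : ∀ g h, l (h⁻¹ * g * h) = l g

/-- An invariant norm on a group: an invariant pseudo-norm vanishing only at the identity. -/
structure IsInvariantNorm {G : Type*} [Group G] (l : G → ℝ≥0) : Prop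
    extends IsInvariantPseudoNorm l where
  eq_zero_iff : ∀ g, l g = 0 ↔ g = 1

/-- Given a finite `D ⊆ G` and a finite set `Q` of non-negative rationals, a map `φ` (only its
values on `D` matter) which is injective on `D`, respects the products that exist in `D`,
and preserves comparison of the pseudo-norm with the numbers in `Q`. -/
structure IsAlmostHom {G C : Type*} [Group G] [Group C] (lG : G → ℝ≥0) (lC : C → ℝ≥0)
    (D : Finset G) (Q : Finset ℚ≥0) (φ : G → C) : Prop where
  injOn : Set.InjOn φ D
  map_mul : ∀ h ∈ D, ∀ g ∈ D, h * g ∈ D → φ (h * g) = φ h * φ g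
  lt_iff : ∀ g ∈ D, ∀ q ∈ Q, lG g < (q : ℝ≥0) ↔ lC (φ g) < (q : ℝ≥0)
  gt_iff : ∀ g ∈ D, ∀ q ∈ Q, lG g > (q : ℝ≥0) ↔ lC (φ g) > (q : ℝ≥0)
  eq_iff : ∀ g ∈ D, ∀ q ∈ Q, lG g = (q : ℝ≥0) ↔ lC (φ g) = (q : ℝ≥0)

/-- Local embeddability of `(G, lG)` into a class `𝒞` of groups with a pseudo-norm. -/
def IsMetricallyLE (𝒞 : ∀ (C : Type) [Group C], (C → ℝ≥0) → Prop)
    {G : Type*} [Group G] (lG : G → ℝ≥0) : Prop :=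
  ∀ (D : Finset G) (Q : Finset ℚ≥0), 0 ∈ Q →
    ∃ (C : Type) (_ : Group C) (lC : C → ℝ≥0), 𝒞 C lC ∧
      ∃ φ : G → C, IsAlmostHom lG lC D Q φ

/-- `(G, l)` is a metrically LEF group: `l` is an invariant pseudo-norm and `(G, l)` is locally
embeddable into the class of all finite groups with an invariant pseudo-norm. -/
def IsMetricallyLEF {G : Type*} [Group G] (l : G → ℝ≥0) : Prop :=
  IsInvariantPseudoNorm l ∧
    IsMetricallyLE (fun C _ lC => Finite C ∧ IsInvariantPseudoNorm lC) l

/-- The word norm with respect to a set `T`: the least length of a product of elements of `T`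
equal to `g` (meaningful when every element is such a product). -/
noncomputable def wordNorm {G : Type*} [Group G] (T : Set G) (g : G) : ℕ :=
  sInf {k : ℕ | ∃ w : List G, w.length = k ∧ (∀ s ∈ w, s ∈ T) ∧ w.prod = g}

/-- `u₃` belongs to the product of the conjugacy classes of `u₂⁻¹` and `u₁⁻¹`. -/
def Xi {P : Type*} [Group P] (u₁ u₂ u₃ : P) : Prop :=
  ∃ x y : P, u₃ = x⁻¹ * u₂⁻¹ * x * y⁻¹ * u₁⁻¹ * y

/-- The four conditions (S1)-(S4) on a group `P`. -/
structure SatisfiesS (P : Type*) [Group P] : Prop where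
  s1 : ∀ a₁ a₂ : P, ∃ x y : P, a₂ = x⁻¹ * a₁⁻¹ * y * x * y⁻¹
  s2 : ∀ a₁ a₂ a₃ : P, ∃ u v : P, a₂ = a₃ * u * a₁⁻¹ * a₃⁻¹ * v * u⁻¹ * v⁻¹
  s3 : ∀ u₁ u₂ u₃ u₄ : P, u₁ ≠ 1 → u₂ ≠ 1 → u₃ ≠ 1 → u₄ ≠ 1 →
    ∃ x y z : P, u₄ = x⁻¹ * u₁ * x * y⁻¹ * u₂ * y * z⁻¹ * u₃ * z
  s4 : ∃ u₁ u₂ u₃ : P, u₁ ≠ 1 ∧ u₂ ≠ 1 ∧ u₃ ≠ 1 ∧ ¬ Xi u₁ u₂ u₃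

/-- The direct sum of copies of `P` indexed by `ℤ`: finitely supported families. -/
def HZ (P : Type*) [Group P] : Subgroup (ℤ → P) where
  carrier := {h | (Function.mulSupport h).Finite}
  one_mem' := by simp
  mul_mem' := fun {a b} ha hb =>
    (Set.Finite.union ha hb).subset (Function.mulSupport_mul a b)
  inv_mem' := fun {a} ha =>
    (congrArg Set.Finite (Function.mulSupport_inv a)).mpr ha

/-- Shifting the index by a constant keeps the support finite. -/
theorem shift_mem {P : Type*} [Group P] (c : ℤ) {h : ℤ → P} (hh : h ∈ HZ P) :
    (fun i => h (i + c)) ∈ HZ P :=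
  Set.Finite.preimage (Function.Injective.injOn (add_left_injective c)) hh

/-- The one-step shift `(hᵢ) ↦ (hᵢ₊₁)` as an automorphism of the direct sum. -/
def shift (P : Type*) [Group P] : MulAut (HZ P) where
  toFun h := ⟨fun i => h.1 (i + 1), shift_mem 1 h.2⟩
  invFun h := ⟨fun i => h.1 (i + -1), shift_mem (-1) h.2⟩
  left_inv h := by ext i; simp
  right_inv h := by ext i; simp
  map_mul' _ _ := rfl

/-- The action of `ℤ` on the direct sum by powers of the shift. -/
def shiftHom (P : Type*) [Group P] : Multiplicative ℤ →* MulAut (HZ P) :=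
  zpowersHom (MulAut (HZ P)) (shift P)

/-- The semidirect product of the direct sum with `ℤ` acting by powers of the shift. -/
abbrev GZ (P : Type*) [Group P] : Type _ :=
  SemidirectProduct (HZ P) (Multiplicative ℤ) (shiftHom P)

/-- The element `t = (1, 1)`. -/
def t (P : Type*) [Group P] : GZ P := SemidirectProduct.inr (Multiplicative.ofAdd 1)

/-- The copy `H₀` of `P` at position `0`, as a subset of the semidirect product. -/
def H0 (P : Type*) [Group P] : Set (GZ P) :=
  {g | ∃ h : HZ P, (∀ i : ℤ, i ≠ 0 → h.1 i = 1) ∧ g = SemidirectProduct.inl h}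

/-- The symmetric set `S = H₀ ∪ {t, t⁻¹}`. -/
def S (P : Type*) [Group P] : Set (GZ P) := H0 P ∪ {t P, (t P)⁻¹}

/-- The word norm on the semidirect product with respect to the smallest
conjugation-invariant set containing `S`. -/
noncomputable def normZ (P : Type*) [Group P] (g : GZ P) : ℝ≥0 :=
  (wordNorm (Group.conjugatesOfSet (S P)) g : ℝ≥0)

/-- The group `G₂`, the restricted wreath product of the alternating group `A₅` with `ℤ`. -/
abbrev G2 : Type := GZ (alternatingGroup (Fin 5))

end MetricLEF

/-!
The norm on `GZ P` takes few values, and they can be read off. Write an element as `(h, t ^ k)`.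
A conjugate of `t` is `(h, t)` with `h j = f j * (f (j + 1))⁻¹` for a finitely supported `f`; this
says that the ordered product of the values of `h` is trivial (`IsCoboundary`).

* For `|k| ≥ 2` the norm is `|k|`. It is at least `|k|` by projection to `ℤ`, and at most `|k|`
  because every element of `P` is a commutator (`wordNorm_le_two_of_right_eq_two`).
* For `|k| = 1` it is `1` or `2`, according to whether the ordered product of `h` is trivial.
* For `k = 0` it is at most the size of the support of `h`, and it is at most `2` if some ordered
  product of conjugates of the values of `h` is trivial, since `h` is then a product of a conjugate
  of `t` and a conjugate of `t⁻¹` (`wordNorm_inl_le_two`). By (S3) this happens whenever the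
  support has at least four elements (`SatisfiesS.conjProducts_count`), so the norm is at most `3`.

The finite groups are the cyclic wreath products of `P` with `ZMod n`, with the norm defined in the
same way, and `wrap n` reads off an element of `GZ P` in them. For every fixed `g` and `g'` and all
large `n` one has `wrap n (g * g') = wrap n g * wrap n g'`. Applied to a shortest word for `g` this
gives `‖wrap n g‖ ≤ ‖g‖` for large `n` (`eventually_wordNorm_wrap_le`). The reverse inequality
comes from the list above: if `wrap n g` is a product of at most two conjugates of generators, then
its support is small, or the conjugates of `t` and `t⁻¹` involved solve a coboundary equation on
`ZMod n`; the solution lifts to `ℤ` because it is constant on the complement of the support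
(`isCoboundary_of_cyclic`). Hence the norms
of `g` and `wrap n g` agree for large `n` (`eventually_wordNorm_wrap_eq`).

For `A₅`, everything follows from the fact that any two nontrivial conjugacy classes have a
`3`-cycle in their product (`exists_isThreeCycle_mul_conj`), and for (S4) from the absence of
involutions in the square of a class of `5`-cycles.
-/

open scoped NNReal

namespace MetricLEF

/-! ### Word norms -/

section WordNorm

variable {G : Type*} [Group G] {T : Set G}

theorem wordNorm_prod_le {w : List G} (hw : ∀ s ∈ w, s ∈ T) : wordNorm T w.prod ≤ w.length :=
  Nat.sInf_le ⟨w, rfl, hw, rfl⟩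

theorem wordNorm_one (T : Set G) : wordNorm T (1 : G) = 0 :=
  Nat.le_zero.mp (wordNorm_prod_le (T := T) (w := []) (by simp))

theorem wordNorm_le_one {g : G} (hg : g ∈ T) : wordNorm T g ≤ 1 := by
  simpa using wordNorm_prod_le (T := T) (w := [g]) (by simpa using hg)

/-- If `T = T⁻¹` generates the group, no junk value occurs: the word norm of every element is the
length of an actual word representing it. -/
theorem exists_word_length_eq_wordNorm (hinv : ∀ s ∈ T, s⁻¹ ∈ T)
    (hgen : Subgroup.closure T = ⊤) (g : G) :
    ∃ w : List G, w.length = wordNorm T g ∧ (∀ s ∈ w, s ∈ T) ∧ w.prod = g := by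
  have hg : g ∈ (Subgroup.closure T).toSubmonoid := hgen ▸ Subgroup.mem_top g
  rw [Subgroup.closure_toSubmonoid] at hg
  obtain ⟨w, hw, rfl⟩ := Submonoid.exists_list_of_mem_closure hg
  exact Nat.sInf_mem (s := {k : ℕ | ∃ v : List G, v.length = k ∧ (∀ s ∈ v, s ∈ T) ∧
    v.prod = w.prod}) ⟨w.length, w, rfl,
      fun s hs => (hw s hs).elim id fun h => by simpa using hinv _ h, rfl⟩

theorem wordNorm_mul_le (hinv : ∀ s ∈ T, s⁻¹ ∈ T) (hgen : Subgroup.closure T = ⊤) (g h : G) :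
    wordNorm T (g * h) ≤ wordNorm T g + wordNorm T h := by
  obtain ⟨v, hv, hvT, rfl⟩ := exists_word_length_eq_wordNorm hinv hgen g
  obtain ⟨w, hw, hwT, rfl⟩ := exists_word_length_eq_wordNorm hinv hgen h
  rw [← hv, ← hw, ← List.length_append, ← List.prod_append]
  refine wordNorm_prod_le fun s hs => ?_
  rcases List.mem_append.mp hs with h | h
  exacts [hvT s h, hwT s h]

theorem wordNorm_inv_le (hinv : ∀ s ∈ T, s⁻¹ ∈ T) (hgen : Subgroup.closure T = ⊤) (g : G) :
    wordNorm T g⁻¹ ≤ wordNorm T g := by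
  obtain ⟨w, hw, hwT, rfl⟩ := exists_word_length_eq_wordNorm hinv hgen g
  rw [← hw, List.prod_inv_reverse]
  refine (wordNorm_prod_le fun s hs => ?_).trans (by simp)
  obtain ⟨r, hr, rfl⟩ := List.mem_map.mp (List.mem_reverse.mp hs)
  exact hinv r (hwT r hr)

theorem wordNorm_inv (hinv : ∀ s ∈ T, s⁻¹ ∈ T) (hgen : Subgroup.closure T = ⊤) (g : G) :
    wordNorm T g⁻¹ = wordNorm T g :=
  (wordNorm_inv_le hinv hgen g).antisymm (by simpa using wordNorm_inv_le hinv hgen g⁻¹)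

theorem wordNorm_conj_le (hinv : ∀ s ∈ T, s⁻¹ ∈ T) (hgen : Subgroup.closure T = ⊤)
    (hconj : ∀ s ∈ T, ∀ c : G, c * s * c⁻¹ ∈ T) (c g : G) :
    wordNorm T (c * g * c⁻¹) ≤ wordNorm T g := by
  obtain ⟨w, hw, hwT, rfl⟩ := exists_word_length_eq_wordNorm hinv hgen g
  rw [← hw, ← MulAut.conj_apply, map_list_prod]
  refine (wordNorm_prod_le fun s hs => ?_).trans (by simp)
  obtain ⟨r, hr, rfl⟩ := List.mem_map.mp hs
  exact hconj r (hwT r hr) c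

theorem wordNorm_conj (hinv : ∀ s ∈ T, s⁻¹ ∈ T) (hgen : Subgroup.closure T = ⊤)
    (hconj : ∀ s ∈ T, ∀ c : G, c * s * c⁻¹ ∈ T) (c g : G) :
    wordNorm T (c * g * c⁻¹) = wordNorm T g := by
  refine (wordNorm_conj_le hinv hgen hconj c g).antisymm ?_
  have h := wordNorm_conj_le hinv hgen hconj c⁻¹ (c * g * c⁻¹)
  rwa [show c⁻¹ * (c * g * c⁻¹) * c⁻¹⁻¹ = g by group] at h

theorem wordNorm_eq_zero_iff (hinv : ∀ s ∈ T, s⁻¹ ∈ T) (hgen : Subgroup.closure T = ⊤) (g : G) :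
    wordNorm T g = 0 ↔ g = 1 := by
  constructor
  · intro h
    obtain ⟨w, hw, -, rfl⟩ := exists_word_length_eq_wordNorm hinv hgen g
    simp [List.length_eq_zero_iff.mp (hw.trans h)]
  · rintro rfl
    exact wordNorm_one T

theorem isInvariantNorm_wordNorm (hinv : ∀ s ∈ T, s⁻¹ ∈ T) (hgen : Subgroup.closure T = ⊤)
    (hconj : ∀ s ∈ T, ∀ c : G, c * s * c⁻¹ ∈ T) :
    IsInvariantNorm fun g => (wordNorm T g : ℝ≥0) where
  map_one := by simp [wordNorm_one]
  map_inv g := by simp [wordNorm_inv hinv hgen]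
  map_mul_le g h := by exact_mod_cast wordNorm_mul_le hinv hgen g h
  map_conj g h := by simpa using wordNorm_conj hinv hgen hconj h⁻¹ g
  eq_zero_iff g := by simp [wordNorm_eq_zero_iff hinv hgen]

theorem mem_of_wordNorm_eq_one {g : G} (hinv : ∀ s ∈ T, s⁻¹ ∈ T) (hgen : Subgroup.closure T = ⊤)
    (h : wordNorm T g = 1) : g ∈ T := by
  obtain ⟨w, hw, hwT, rfl⟩ := exists_word_length_eq_wordNorm hinv hgen g
  obtain ⟨s, rfl⟩ := List.length_eq_one_iff.mp (hw.trans h)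
  simpa using hwT

theorem exists_mul_of_wordNorm_eq_two {g : G} (hinv : ∀ s ∈ T, s⁻¹ ∈ T)
    (hgen : Subgroup.closure T = ⊤) (h : wordNorm T g = 2) :
    ∃ a ∈ T, ∃ b ∈ T, g = a * b := by
  obtain ⟨w, hw, hwT, rfl⟩ := exists_word_length_eq_wordNorm hinv hgen g
  obtain ⟨a, b, rfl⟩ := List.length_eq_two.mp (hw.trans h)
  exact ⟨a, hwT a (by simp), b, hwT b (by simp), by simp⟩

theorem inv_mem_conjugatesOfSet {S : Set G} (hS : ∀ s ∈ S, s⁻¹ ∈ S) :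
    ∀ s ∈ Group.conjugatesOfSet S, s⁻¹ ∈ Group.conjugatesOfSet S := by
  intro s hs
  obtain ⟨a, ha, c, rfl⟩ := by simpa only [Group.mem_conjugatesOfSet_iff, isConj_iff] using hs
  rw [show (c * a * c⁻¹)⁻¹ = c * a⁻¹ * c⁻¹ by group]
  exact Group.conj_mem_conjugatesOfSet (Group.subset_conjugatesOfSet (hS a ha))

theorem closure_conjugatesOfSet_eq_top {S : Set G} (h : Subgroup.closure S = ⊤) :
    Subgroup.closure (Group.conjugatesOfSet S) = ⊤ :=
  top_unique (h ▸ Subgroup.closure_mono Group.subset_conjugatesOfSet)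

end WordNorm

/-! ### The alternating group of degree five -/

section AlternatingFive

open Equiv

/-- Checked on representatives of the three nontrivial `S₅`-classes of even permutations. -/
theorem exists_conj_mul_card_support_eq_three_aux :
    ∀ u ∈ ({c[0, 1, 2], c[0, 1] * c[2, 3], finRotate 5} : Finset (Perm (Fin 5))),
      ∀ v : Perm (Fin 5), Perm.sign v = 1 → v ≠ 1 →
      ∃ z : Perm (Fin 5), Perm.sign z = 1 ∧ (u * (z * v * z⁻¹)).support.card = 3 := by
  decide +kernel

theorem exists_conj_mem_representatives :
    ∀ u : Perm (Fin 5), Perm.sign u = 1 → u ≠ 1 → ∃ c : Perm (Fin 5),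
      c * u * c⁻¹ ∈ ({c[0, 1, 2], c[0, 1] * c[2, 3], finRotate 5} : Finset (Perm (Fin 5))) := by
  decide +kernel

/-- Any two nontrivial conjugacy classes of `A₅` have a `3`-cycle in their product. -/
theorem exists_isThreeCycle_mul_conj {u v : alternatingGroup (Fin 5)} (hu : u ≠ 1) (hv : v ≠ 1) :
    ∃ z : alternatingGroup (Fin 5), (u * (z * v * z⁻¹) : Perm (Fin 5)).IsThreeCycle := by
  obtain ⟨u, hu'⟩ := u
  obtain ⟨v, hv'⟩ := v
  rw [Perm.mem_alternatingGroup] at hu' hv'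
  obtain ⟨c, hc⟩ := exists_conj_mem_representatives u hu' (by simpa [Subtype.ext_iff] using hu)
  obtain ⟨z, hz, h⟩ := exists_conj_mul_card_support_eq_three_aux _ hc (c * v * c⁻¹)
    (by simp [hv', Int.units_mul_self, mul_comm]) (by simpa [Subtype.ext_iff] using hv)
  refine ⟨⟨c⁻¹ * z * c, by simp [Perm.mem_alternatingGroup, hz, mul_comm]⟩, ?_⟩
  rw [← card_support_eq_three_iff, ← h, ← Perm.card_support_conj (σ := c)]
  congr 2
  simp only [Subgroup.coe_inv]
  group

theorem exists_mul_conj_eq {u v w : alternatingGroup (Fin 5)} (hu : u ≠ 1) (hv : v ≠ 1)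
    (hw : (w : Perm (Fin 5)).IsThreeCycle) :
    ∃ x y : alternatingGroup (Fin 5), w = x * u * x⁻¹ * (y * v * y⁻¹) := by
  obtain ⟨z, hz⟩ := exists_isThreeCycle_mul_conj hu hv
  obtain ⟨c, rfl⟩ := isConj_iff.mp
    (alternatingGroup.isThreeCycle_isConj (by simp) (σ := u * (z * v * z⁻¹)) (by simpa using hz) hw)
  exact ⟨c, c * z, by group⟩

/-- The product of the class of `3`-cycles with any nontrivial class contains every nontrivial
element, because the class of `3`-cycles is closed under inversion. -/
theorem exists_isThreeCycle_mul_conj_eq {v w : alternatingGroup (Fin 5)} (hv : v ≠ 1)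
    (hw : w ≠ 1) :
    ∃ r y : alternatingGroup (Fin 5), (r : Perm (Fin 5)).IsThreeCycle ∧ w = r * (y * v * y⁻¹) := by
  obtain ⟨z, hz⟩ := exists_isThreeCycle_mul_conj hw (inv_ne_one.mpr hv)
  exact ⟨w * (z * v⁻¹ * z⁻¹), z, by simpa using hz, by group⟩

/-- Every element of `A₅` is a commutator. -/
theorem exists_commutator_eq (a : alternatingGroup (Fin 5)) :
    ∃ x y : alternatingGroup (Fin 5), a = x * y * x⁻¹ * y⁻¹ := by
  rcases eq_or_ne a 1 with rfl | ha
  · exact ⟨1, 1, by simp⟩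
  have h3 : (c[0, 1, 2] : Perm (Fin 5)).IsThreeCycle := by
    rw [← card_support_eq_three_iff]; decide
  obtain ⟨r, y, hr, rfl⟩ := exists_isThreeCycle_mul_conj_eq
    (v := ⟨c[0, 1, 2], h3.mem_alternatingGroup⟩) (by simp [Subtype.ext_iff]; decide) ha
  obtain ⟨c, hc⟩ := isConj_iff.mp
    (alternatingGroup.isThreeCycle_isConj (by simp) (σ := r⁻¹)
      (τ := ⟨c[0, 1, 2], h3.mem_alternatingGroup⟩) (by simpa using hr) h3)
  exact ⟨r, y * c, by rw [← hc]; group⟩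

theorem mul_conj_finRotate_sq :
    ∀ z : Perm (Fin 5), Perm.sign z = 1 → (finRotate 5 * (z * finRotate 5 * z⁻¹)) ^ 2 = 1 →
      finRotate 5 * (z * finRotate 5 * z⁻¹) = 1 := by
  decide +kernel

/-- For (S4) take the class of a `5`-cycle twice: its square contains no involution. -/
theorem satisfiesS_alternatingGroup_five : SatisfiesS (alternatingGroup (Fin 5)) where
  s1 a₁ a₂ := by
    -- The equation says that `a₂ * a₁` is the commutator of `a₂ * y` and `x`.
    obtain ⟨p, q, h⟩ := exists_commutator_eq (a₂ * a₁)
    obtain rfl : a₁ = a₂⁻¹ * (p * q * p⁻¹ * q⁻¹) := by rw [← h]; group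
    exact ⟨q, a₂⁻¹ * p, by group⟩
  s2 a₁ a₂ a₃ := by
    -- The equation says that `a₁⁻¹ * (a₃⁻¹ * a₂⁻¹ * a₃)` is a commutator with second entry `u`.
    obtain ⟨p, q, h⟩ := exists_commutator_eq (a₁⁻¹ * (a₃⁻¹ * a₂⁻¹ * a₃))
    obtain rfl : a₂ = a₃ * (a₁ * (p * q * p⁻¹ * q⁻¹))⁻¹ * a₃⁻¹ := by rw [← h]; group
    exact ⟨q, a₃ * a₁ * p, by group⟩
  s3 u₁ u₂ u₃ u₄ h₁ h₂ h₃ h₄ := by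
    obtain ⟨r, z, hr, rfl⟩ := exists_isThreeCycle_mul_conj_eq h₃ h₄
    obtain ⟨x, y, rfl⟩ := exists_mul_conj_eq h₁ h₂ hr
    exact ⟨x⁻¹, y⁻¹, z⁻¹, by group⟩
  s4 := by
    let r : alternatingGroup (Fin 5) := ⟨finRotate 5, by simp [Perm.mem_alternatingGroup]; decide⟩
    let s : alternatingGroup (Fin 5) := ⟨c[0, 1] * c[2, 3], by
      simp [Perm.mem_alternatingGroup]; decide⟩
    have hr : r ≠ 1 := by simp [Subtype.ext_iff, r]; decide
    have hs : s ≠ 1 := by simp [Subtype.ext_iff, s]; decide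
    have hs2 : s ^ 2 = 1 := by simp [Subtype.ext_iff, s]; decide
    refine ⟨r⁻¹, r⁻¹, s, inv_ne_one.mpr hr, inv_ne_one.mpr hr, hs, ?_⟩
    rintro ⟨x, y, h⟩
    have hx : x * s * x⁻¹ = r * (x * y⁻¹ * r * (x * y⁻¹)⁻¹) := by rw [h]; group
    have h2 : (x * s * x⁻¹) ^ 2 = 1 := by rw [conj_pow, hs2]; simp
    have key := mul_conj_finRotate_sq (x * y⁻¹ : alternatingGroup (Fin 5))
      (Perm.mem_alternatingGroup.mp (x * y⁻¹).2)
    rw [hx] at h2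
    have h1 : r * (x * y⁻¹ * r * (x * y⁻¹)⁻¹) = 1 := Subtype.ext (key (congrArg Subtype.val h2))
    rw [← hx] at h1
    exact hs (by simpa using h1)

end AlternatingFive

/-! ### Finitely supported families and coboundaries -/

section Families

/-- A family supported in a finite set of `m` indices is a product of `m` families, each supported
at a single index. -/
theorem exists_list_prod_mulSingle {ι P : Type*} [DecidableEq ι] [Group P]
    (s : Finset ι) :
    ∀ h : ι → P, (∀ i ∉ s, h i = 1) →
      ∃ l : List (ι × P), l.length = s.card ∧
        (l.map fun x => (Pi.mulSingle x.1 x.2 : ι → P)).prod = h := by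
  induction s using Finset.induction_on with
  | empty =>
    intro h hh
    exact ⟨[], rfl, funext fun i => (hh i (by simp)).symm⟩
  | insert a s ha ih =>
    intro h hh
    obtain ⟨l, hl, hp⟩ := ih (Function.update h a 1) fun i hi => by
      rcases eq_or_ne i a with rfl | hia
      · simp
      · simpa [hia] using hh i (by simp [hia, hi])
    refine ⟨(a, h a) :: l, by simp [hl, ha], funext fun i => ?_⟩
    rw [List.map_cons, List.prod_cons, hp]
    rcases eq_or_ne i a with rfl | hia
    · simp
    · simp [hia]

variable {P : Type*} [Group P]

theorem exists_window {h : ℤ → P} (hh : h ∈ HZ P) :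
    ∃ M : ℕ, ∀ j : ℤ, (j < -M ∨ (M : ℤ) ≤ j) → h j = 1 := by
  have hfin : (Function.mulSupport h).Finite := hh
  obtain ⟨M, hM⟩ := (hfin.image Int.natAbs).bddAbove
  refine ⟨M + 1, fun j hj => ?_⟩
  by_contra hne
  have := hM (Set.mem_image_of_mem Int.natAbs (Function.mem_mulSupport.mpr hne))
  push_cast at hj
  omega

theorem mem_HZ_of_window {h : ℤ → P} {a : ℤ} {N : ℕ}
    (hh : ∀ j : ℤ, (j < a ∨ a + N ≤ j) → h j = 1) : h ∈ HZ P := by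
  refine (Set.finite_Ico a (a + N)).subset fun j hj => ?_
  by_contra hne
  rw [Set.mem_Ico] at hne
  exact hj (hh j (by omega))

/-- The family supported at the single index `a`, with value `p` there. -/
noncomputable def single (a : ℤ) (p : P) : HZ P :=
  ⟨Pi.mulSingle a p, (Set.finite_singleton a).subset Pi.mulSupport_mulSingle_subset⟩

/-- The product `c (a + n - 1) * ⋯ * c (a + 1) * c a` of `n` consecutive values of `c`. -/
def seqProd (c : ℤ → P) (a : ℤ) : ℕ → P
  | 0 => 1
  | n + 1 => c (a + n) * seqProd c a n

theorem seqProd_succ (c : ℤ → P) (a : ℤ) (n : ℕ) :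
    seqProd c a (n + 1) = c (a + n) * seqProd c a n := rfl

theorem seqProd_congr {c d : ℤ → P} {a : ℤ} {n : ℕ}
    (h : ∀ i : ℕ, i < n → c (a + i) = d (a + i)) : seqProd c a n = seqProd d a n := by
  induction n with
  | zero => rfl
  | succ n ih =>
    rw [seqProd_succ, seqProd_succ, h n n.lt_succ_self, ih fun i hi => h i (hi.trans n.lt_succ_self)]

theorem seqProd_add {c : ℤ → P} {a : ℤ} {N : ℕ} (h : ∀ j, a + N ≤ j → c j = 1) (m : ℕ) :
    seqProd c a (N + m) = seqProd c a N := by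
  induction m with
  | zero => rfl
  | succ m ih => rw [← add_assoc, seqProd_succ, ih, h _ (by push_cast; omega), one_mul]

/-- The family `c` is of the form `W (j + 1) * (W j)⁻¹` for a finitely supported `W`. For a finitely
supported `c` this says that the ordered product of its values is trivial. -/
def IsCoboundary (c : ℤ → P) : Prop :=
  ∃ W ∈ HZ P, ∀ j, W (j + 1) = c j * W j

theorem isCoboundary_of_seqProd {c : ℤ → P} {a : ℤ} {N : ℕ}
    (hc : ∀ j : ℤ, (j < a ∨ a + N ≤ j) → c j = 1) (h : seqProd c a N = 1) : IsCoboundary c := by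
  refine ⟨fun j => seqProd c a (j - a).toNat, mem_HZ_of_window (a := a) (N := N) fun j hj => ?_,
    fun j => ?_⟩
  · rcases hj with hj | hj
    · simp [show (j - a).toNat = 0 by omega, seqProd]
    · obtain ⟨m, hm⟩ : ∃ m : ℕ, (j - a).toNat = N + m := ⟨(j - a).toNat - N, by omega⟩
      rw [hm, seqProd_add (fun i hi => hc i (Or.inr hi)), h]
  · rcases lt_or_ge j a with hj | hj
    · simp [show (j - a).toNat = 0 by omega, show (j + 1 - a).toNat = 0 by omega, hc j (Or.inl hj)]
    · dsimp only
      rw [show (j + 1 - a).toNat = (j - a).toNat + 1 by omega, seqProd_succ,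
        show a + ((j - a).toNat : ℤ) = j by omega]

end Families

/-! ### Products of conjugacy classes -/

section Reach

variable {P : Type*} [Group P]

theorem SatisfiesS.exists_commutator_eq (hS : SatisfiesS P) (a : P) :
    ∃ x y : P, a = x⁻¹ * y * x * y⁻¹ := by
  simpa using hS.s1 1 a

/-- A group with a nontrivial central element would, by (S3), have two elements, and then
not every element is a commutator. -/
theorem SatisfiesS.eq_one_of_forall_commute (hS : SatisfiesS P) {u : P} (hu : ∀ x, Commute u x) :
    u = 1 := by
  by_contra hne
  have h2 : ∀ v : P, v = 1 ∨ v = u := fun v => by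
    by_contra! hv
    obtain ⟨x, y, z, h⟩ := hS.s3 u u u v hne hne hne hv.1
    obtain ⟨x', y', z', h'⟩ := hS.s3 u u u u hne hne hne hne
    have hc : ∀ w : P, w⁻¹ * u * w = u := fun w => by rw [mul_assoc, (hu w).eq]; group
    have e : ∀ x y z : P, x⁻¹ * u * x * y⁻¹ * u * y * z⁻¹ * u * z = u * u * u := fun x y z => by
      calc _ = (x⁻¹ * u * x) * (y⁻¹ * u * y) * (z⁻¹ * u * z) := by group
        _ = _ := by rw [hc, hc, hc]
    rw [e] at h h'
    exact hv.2 (h.trans h'.symm)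
  obtain ⟨x, y, h⟩ := hS.exists_commutator_eq u
  have hxy : Commute y x := by
    rcases h2 y with rfl | rfl
    · exact Commute.one_left x
    · exact hu x
  apply hne
  rw [h, mul_assoc x⁻¹ y x, hxy.eq]
  group

/-- The possible values of the ordered product of `N` consecutive values of `h`, from index `a` on,
once each of them may be replaced by a conjugate. -/
def conjProducts (h : ℤ → P) (a : ℤ) (N : ℕ) : Set P :=
  {p | ∃ c : ℤ → P, (∀ j, IsConj (h j) (c j)) ∧ seqProd c a N = p}

theorem mul_mem_conjProducts {h : ℤ → P} {a : ℤ} {N : ℕ} {x p : P} (hx : IsConj (h (a + N)) x)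
    (hp : p ∈ conjProducts h a N) : x * p ∈ conjProducts h a (N + 1) := by
  obtain ⟨c, hc, rfl⟩ := hp
  refine ⟨Function.update c (a + N) x, fun j => ?_, ?_⟩
  · rcases eq_or_ne j (a + N) with rfl | hj
    · simpa using hx
    · simpa [hj] using hc j
  · rw [seqProd_succ, Function.update_self]
    congr 1
    exact seqProd_congr fun i hi => Function.update_of_ne (by omega) _ _

open Classical in
/-- What (S3) implies on ordered products of conjugates, by the number of nontrivial values. -/
theorem SatisfiesS.conjProducts_count (hS : SatisfiesS P) (h : ℤ → P) (a : ℤ) (N : ℕ) :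
    (Nat.count (fun i : ℕ => h (a + i) ≠ 1) N = 0 → 1 ∈ conjProducts h a N) ∧
    (Nat.count (fun i : ℕ => h (a + i) ≠ 1) N = 1 →
      ∃ u : P, u ≠ 1 ∧ ∀ x, x⁻¹ * u * x ∈ conjProducts h a N) ∧
    (Nat.count (fun i : ℕ => h (a + i) ≠ 1) N = 2 → ∃ u v : P, u ≠ 1 ∧ v ≠ 1 ∧
      ∀ x y, x⁻¹ * u * x * (y⁻¹ * v * y) ∈ conjProducts h a N) ∧
    (3 ≤ Nat.count (fun i : ℕ => h (a + i) ≠ 1) N → ∀ p : P, p ≠ 1 → p ∈ conjProducts h a N) ∧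
    (4 ≤ Nat.count (fun i : ℕ => h (a + i) ≠ 1) N → 1 ∈ conjProducts h a N) := by
  have hconj : ∀ u x : P, IsConj u (x⁻¹ * u * x) := fun u x => isConj_iff.mpr ⟨x⁻¹, by simp⟩
  induction N with
  | zero => simpa using ⟨h, fun j => IsConj.refl _, rfl⟩
  | succ N ih =>
    obtain ⟨i0, i1, i2, i3, i4⟩ := ih
    rw [Nat.count_succ]
    by_cases hN : h (a + N) = 1
    · have step : ∀ p ∈ conjProducts h a N, p ∈ conjProducts h a (N + 1) := fun p hp => by
        simpa [hN] using mul_mem_conjProducts (IsConj.refl (h (a + N))) hp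
      simp only [hN, ne_eq, not_true_eq_false, if_false, add_zero] at i0 i1 i2 i3 i4 ⊢
      refine ⟨fun hc => step _ (i0 hc), fun hc => ?_, fun hc => ?_,
        fun hc p hp => step _ (i3 hc p hp), fun hc => step _ (i4 hc)⟩
      · obtain ⟨u, hu, H⟩ := i1 hc
        exact ⟨u, hu, fun x => step _ (H x)⟩
      · obtain ⟨u, v, hu, hv, H⟩ := i2 hc
        exact ⟨u, v, hu, hv, fun x y => step _ (H x y)⟩
    · have step : ∀ p ∈ conjProducts h a N, ∀ x : P,
          x⁻¹ * h (a + N) * x * p ∈ conjProducts h a (N + 1) := fun p hp x =>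
        mul_mem_conjProducts (hconj _ x) hp
      simp only [ne_eq, hN, not_false_eq_true, if_true] at i0 i1 i2 i3 i4 ⊢
      refine ⟨fun hc => by omega, fun hc => ?_, fun hc => ?_, fun hc p hp => ?_, fun hc => ?_⟩
      · exact ⟨_, hN, fun x => by simpa using step _ (i0 (by omega)) x⟩
      · obtain ⟨u, hu, H⟩ := i1 (by omega)
        exact ⟨_, u, hN, hu, fun x y => step _ (H y) x⟩
      · rcases eq_or_lt_of_le (show 2 ≤ _ by exact Nat.le_of_succ_le_succ hc) with hc2 | hc2
        · obtain ⟨u, v, hu, hv, H⟩ := i2 hc2.symm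
          obtain ⟨x, y, z, rfl⟩ := hS.s3 _ u v p hN hu hv hp
          simpa only [mul_assoc] using step _ (H y z) x
        · -- Some conjugate of `h (a + N)` differs from `p`, as `h (a + N)` is not central.
          obtain ⟨x, hx⟩ : ∃ x : P, x⁻¹ * h (a + N) * x ≠ p := by
            by_contra! hall
            refine hN (hS.eq_one_of_forall_commute fun x => ?_)
            have e := (hall x).trans (hall 1).symm
            rw [inv_one, one_mul, mul_one, mul_assoc, inv_mul_eq_iff_eq_mul] at e
            exact e
          have hne : (x⁻¹ * h (a + N) * x)⁻¹ * p ≠ 1 := by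
            rwa [Ne, inv_mul_eq_one]
          simpa only [mul_inv_cancel_left] using step _ (i3 hc2 _ hne) x
      · simpa using step _ (i3 (by omega) (h (a + N))⁻¹ (inv_ne_one.mpr hN)) 1

end Reach

/-! ### The group `GZ P` and upper bounds for its norm -/

section Upper

open SemidirectProduct

variable {P : Type*} [Group P]

theorem shiftHom_apply (k : ℤ) (h : HZ P) (i : ℤ) :
    (shiftHom P (Multiplicative.ofAdd k) h).1 i = h.1 (i + k) := by
  have hs : ∀ (h : HZ P) (i : ℤ), (shift P h).1 i = h.1 (i + 1) := fun _ _ => rfl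
  have hs' : ∀ (h : HZ P) (i : ℤ), ((shift P)⁻¹ h).1 i = h.1 (i + -1) := fun _ _ => rfl
  have hk : shiftHom P (Multiplicative.ofAdd k) = shift P ^ k := rfl
  rw [hk]
  induction k using Int.induction_on generalizing h i with
  | zero => simp
  | succ k ih =>
    rw [zpow_add_one, MulAut.mul_apply, ih _ _ rfl, hs]
    exact congrArg h.1 (by ring)
  | pred k ih =>
    rw [zpow_sub_one, MulAut.mul_apply, ih _ _ rfl, hs']
    exact congrArg h.1 (by ring)

theorem mul_left_apply (g g' : GZ P) (i : ℤ) :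
    (g * g').left.1 i = g.left.1 i * g'.left.1 (i + g.right.toAdd) := by
  rw [mul_left]
  exact congrArg _ (shiftHom_apply _ _ _)

theorem inv_left_apply (g : GZ P) (i : ℤ) :
    (g⁻¹).left.1 i = (g.left.1 (i - g.right.toAdd))⁻¹ := by
  rw [inv_left]
  exact (shiftHom_apply (-g.right.toAdd) _ _).trans (by rw [← sub_eq_add_neg]; rfl)

theorem GZ.ext' {g g' : GZ P} (h : ∀ i, g.left.1 i = g'.left.1 i)
    (h' : g.right.toAdd = g'.right.toAdd) : g = g' :=
  SemidirectProduct.ext (Subtype.ext (funext h)) h'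

@[simp] theorem t_left : (t P).left = 1 := rfl

@[simp] theorem t_right : (t P).right = Multiplicative.ofAdd 1 := rfl

theorem t_zpow (k : ℤ) : (t P) ^ k = inr (Multiplicative.ofAdd k) := by
  rw [t, ← map_zpow, ← ofAdd_zsmul, smul_eq_mul, mul_one]

theorem single_apply (a i : ℤ) (p : P) : (single a p).1 i = if i = a then p else 1 := by
  simp [single, Pi.mulSingle_apply]

theorem inl_single_zero_mem (p : P) : (inl (single 0 p) : GZ P) ∈ S P :=
  Or.inl ⟨_, fun i hi => by simp [single_apply, hi], rfl⟩

theorem inl_single_eq_conj (a : ℤ) (p : P) :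
    (inl (single a p) : GZ P) = t P ^ (-a) * inl (single 0 p) * (t P ^ (-a))⁻¹ := by
  refine GZ.ext' (fun i => ?_) (by simp)
  simp only [mul_left_apply, inv_left_apply, t_zpow, left_inl, left_inr, right_inr, right_inl,
    mul_right, single_apply]
  simp [← sub_eq_add_neg, sub_eq_zero]

theorem t_mem_S : t P ∈ S P := Or.inr (Or.inl rfl)

theorem inv_mem_S : ∀ s ∈ S P, s⁻¹ ∈ S P := by
  rintro s (⟨h, hh, rfl⟩ | rfl | rfl)
  · exact Or.inl ⟨h⁻¹, fun i hi => inv_eq_one.mpr (hh i hi), (map_inv _ _).symm⟩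
  · exact Or.inr (Or.inr rfl)
  · exact Or.inr (Or.inl (inv_inv _))

theorem exists_list_prod_single {s : Finset ℤ} {h : HZ P} (hh : ∀ i ∉ s, h.1 i = 1) :
    ∃ l : List (ℤ × P), l.length = s.card ∧ (l.map fun x => single x.1 x.2).prod = h := by
  obtain ⟨l, hl, hp⟩ := exists_list_prod_mulSingle s h.1 hh
  refine ⟨l, hl, Subtype.ext ?_⟩
  rw [← hp, ← Subgroup.subtype_apply, map_list_prod, List.map_map]
  rfl

theorem closure_S_eq_top : Subgroup.closure (S P) = ⊤ := by
  refine (Subgroup.eq_top_iff' _).mpr fun g => ?_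
  have ht : ∀ k : ℤ, t P ^ k ∈ Subgroup.closure (S P) := fun k =>
    zpow_mem (Subgroup.subset_closure t_mem_S) k
  rw [← inl_left_mul_inr_right g]
  refine mul_mem ?_ (t_zpow (P := P) g.right.toAdd ▸ ht _)
  have hfin : (Function.mulSupport g.left.1).Finite := g.left.2
  obtain ⟨l, -, hl⟩ := exists_list_prod_single (s := hfin.toFinset) (h := g.left) (by simp)
  rw [← hl, map_list_prod, List.map_map]
  refine list_prod_mem fun x hx => ?_
  obtain ⟨y, -, rfl⟩ := List.mem_map.mp hx
  rw [Function.comp_apply, inl_single_eq_conj]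
  exact mul_mem (mul_mem (ht _) (Subgroup.subset_closure (inl_single_zero_mem _)))
    (inv_mem (ht _))

theorem fg_GZ [Finite P] : Group.FG (GZ P) := by
  have hS : (S P).Finite := by
    refine Set.Finite.union ((Set.finite_range fun p : P => (inl (single 0 p) : GZ P)).subset ?_)
      (Set.toFinite _)
    rintro _ ⟨h, hh, rfl⟩
    refine ⟨h.1 0, congrArg _ (Subtype.ext (funext fun i => ?_))⟩
    rw [single_apply]
    split_ifs with hi
    · rw [hi]
    · exact (hh i hi).symm
  exact Group.fg_iff.mpr ⟨S P, closure_S_eq_top, hS⟩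

/-- The smallest conjugation-invariant set containing `S`. -/
abbrev T (P : Type*) [Group P] : Set (GZ P) := Group.conjugatesOfSet (S P)

theorem inv_mem_T : ∀ s ∈ T P, s⁻¹ ∈ T P := inv_mem_conjugatesOfSet inv_mem_S

theorem closure_T_eq_top : Subgroup.closure (T P) = ⊤ :=
  closure_conjugatesOfSet_eq_top closure_S_eq_top

theorem conj_mem_T : ∀ s ∈ T P, ∀ c : GZ P, c * s * c⁻¹ ∈ T P :=
  fun _ hs _ => Group.conj_mem_conjugatesOfSet hs

theorem isInvariantNorm_normZ : IsInvariantNorm (normZ P) :=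
  isInvariantNorm_wordNorm inv_mem_T closure_T_eq_top conj_mem_T

theorem inl_single_mem_T (a : ℤ) (p : P) : (inl (single a p) : GZ P) ∈ T P := by
  rw [inl_single_eq_conj]
  exact conj_mem_T _ (Group.subset_conjugatesOfSet (inl_single_zero_mem p)) _

theorem t_mem_T : t P ∈ T P := Group.subset_conjugatesOfSet t_mem_S

theorem wordNorm_inl_le_card {s : Finset ℤ} {h : HZ P} (hh : ∀ i ∉ s, h.1 i = 1) :
    wordNorm (T P) (inl h) ≤ s.card := by
  obtain ⟨l, hl, rfl⟩ := exists_list_prod_single hh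
  rw [map_list_prod, List.map_map, ← hl]
  refine (wordNorm_prod_le fun x hx => ?_).trans (by simp)
  obtain ⟨y, -, rfl⟩ := List.mem_map.mp hx
  exact inl_single_mem_T _ _

/-- An element `(h, t)` is a conjugate of `t` as soon as the ordered product of `h` is trivial. -/
theorem mem_T_of_isCoboundary {g : GZ P} (h1 : g.right.toAdd = 1)
    (hg : IsCoboundary fun j => (g.left.1 j)⁻¹) : g ∈ T P := by
  obtain ⟨W, hW, hWg⟩ := hg
  have : g = inl ⟨W, hW⟩ * t P * (inl ⟨W, hW⟩)⁻¹ := by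
    refine GZ.ext' (fun i => ?_) (by simp [h1])
    have e : ∀ j, (inl ⟨W, hW⟩ : GZ P).left.1 j = W j := fun _ => rfl
    simp only [mul_left_apply, inv_left_apply, e, mul_right, right_inl, t_right, t_left]
    simp [hWg]
  rw [this]
  exact conj_mem_T _ t_mem_T _

theorem wordNorm_le_two_of_right_eq_one {g : GZ P} (h1 : g.right.toAdd = 1) :
    wordNorm (T P) g ≤ 2 := by
  obtain ⟨M, hM⟩ := exists_window g.left.2
  set c : ℤ → P := fun j => (g.left.1 j)⁻¹ with hc
  -- A factor at the first index to the right of the support makes the ordered product trivial.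
  set p : P := (seqProd c (-M) (2 * M))⁻¹ with hp
  have hg : g = inl (single M p) * (inl (single M p)⁻¹ * g) := by simp
  have hmem : inl (single M p)⁻¹ * g ∈ T P := by
    have hval : ∀ j, ((inl (single M p)⁻¹ * g).left.1 j)⁻¹ =
        c j * if j = M then p else 1 := fun j => by
      rw [map_inv, mul_left_apply, inv_left_apply]
      simp [single_apply, hc]
    refine mem_T_of_isCoboundary (by simpa using h1) ?_
    simp only [hval]
    refine isCoboundary_of_seqProd (a := -M) (N := 2 * M + 1) (fun j hj => ?_) ?_
    · push_cast at hj
      rw [if_neg (by omega), mul_one]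
      simp only [hc, inv_eq_one]
      exact hM j (by omega)
    · rw [seqProd_succ, seqProd_congr (d := c) fun i hi => by rw [if_neg (by omega), mul_one],
        if_pos (by push_cast; ring)]
      have : c (-M + (2 * M : ℕ)) = 1 := by
        simp only [hc, inv_eq_one]
        exact hM _ (by push_cast; omega)
      rw [this, one_mul, hp, inv_mul_cancel]
  have h2 := wordNorm_mul_le inv_mem_T closure_T_eq_top (inl (single M p)) (inl (single M p)⁻¹ * g)
  rw [← hg] at h2
  have := wordNorm_le_one (inl_single_mem_T (M : ℤ) p)
  have := wordNorm_le_one hmem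
  omega

/-- As every element of `P` is a commutator, every `(h, t ^ 2)` is a product `(a, t) * (b, t)` in
which `a` and `b` have trivial ordered products: the family `a` takes three values
`x, y, (x * y)⁻¹` to the right of the support of `h`. -/
theorem wordNorm_le_two_of_right_eq_two (hS : SatisfiesS P) {g : GZ P} (h2 : g.right.toAdd = 2) :
    wordNorm (T P) g ≤ 2 := by
  obtain ⟨M, hM⟩ := exists_window g.left.2
  set c : ℤ → P := fun j => (g.left.1 j)⁻¹ with hc
  set q : P := seqProd c (-M) (2 * M) with hq
  obtain ⟨x, y, hxy⟩ := hS.exists_commutator_eq q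
  set d : ℤ → P := fun j => if j = M then x⁻¹ else if j = M + 1 then y else
    if j = M + 2 then x * y⁻¹ else 1 with hd
  have hd1 : ∀ j : ℤ, (j < M ∨ (M : ℤ) + 3 ≤ j) → d j = 1 := fun j hj => by
    simp only [hd]
    rw [if_neg (by omega), if_neg (by omega), if_neg (by omega)]
  have hd2 : d M = x⁻¹ ∧ d (M + 1) = y ∧ d (M + 2) = x * y⁻¹ := by simp [hd]
  set D : HZ P := ⟨d, mem_HZ_of_window (N := 3) (by exact_mod_cast hd1)⟩ with hD
  have hA : inl D⁻¹ * t P ∈ T P := by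
    have hval : ∀ j, ((inl D⁻¹ * t P).left.1 j)⁻¹ = d j := fun j => by
      rw [map_inv, mul_left_apply, inv_left_apply]
      simp [hD]
    refine mem_T_of_isCoboundary (by simp) ?_
    simp only [hval]
    refine isCoboundary_of_seqProd (a := M) (N := 3) (by exact_mod_cast hd1) ?_
    simp [seqProd, hd2]
  have hX : inl D * g * (t P)⁻¹ ∈ T P := by
    have hval : ∀ j, ((inl D * g * (t P)⁻¹).left.1 j)⁻¹ = c j * (d j)⁻¹ := fun j => by
      rw [mul_left_apply, mul_left_apply, inv_left_apply]
      simp [hD, hc]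
    refine mem_T_of_isCoboundary (by simp [h2]) ?_
    simp only [hval]
    have hc1 : ∀ j : ℤ, (j < -M ∨ (M : ℤ) ≤ j) → c j = 1 := fun j hj => by simp [hc, hM j hj]
    refine isCoboundary_of_seqProd (a := -M) (N := 2 * M + 3) (fun j hj => ?_) ?_
    · push_cast at hj
      rw [hc1 j (by omega), hd1 j (by omega), inv_one, one_mul]
    · rw [seqProd_succ, seqProd_succ, seqProd_succ,
        seqProd_congr (d := c) fun i hi => by rw [hd1 _ (by omega), inv_one, mul_one], ← hq,
        hc1 _ (by push_cast; omega), hc1 _ (by push_cast; omega), hc1 _ (by push_cast; omega),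
        show -(M : ℤ) + (2 * M : ℕ) = M by push_cast; ring,
        show -(M : ℤ) + (2 * M + 1 : ℕ) = M + 1 by push_cast; ring,
        show -(M : ℤ) + (2 * M + 2 : ℕ) = M + 2 by push_cast; ring,
        hd2.1, hd2.2.1, hd2.2.2, hxy]
      group
  have hg : g = inl D⁻¹ * t P * ((t P)⁻¹ * (inl D * g * (t P)⁻¹) * (t P)⁻¹⁻¹) := by
    rw [map_inv]
    group
  have hle := wordNorm_mul_le inv_mem_T closure_T_eq_top (inl D⁻¹ * t P)
    ((t P)⁻¹ * (inl D * g * (t P)⁻¹) * (t P)⁻¹⁻¹)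
  rw [← hg] at hle
  have := wordNorm_le_one hA
  have := wordNorm_le_one (conj_mem_T _ hX (t P)⁻¹)
  omega

theorem wordNorm_le_of_two_le (hS : SatisfiesS P) {g : GZ P} {k : ℕ} (hk : 2 ≤ k)
    (h : g.right.toAdd = k) : wordNorm (T P) g ≤ k := by
  induction k, hk using Nat.le_induction generalizing g with
  | base => exact wordNorm_le_two_of_right_eq_two hS h
  | succ k hk ih =>
    have h1 := ih (g := g * (t P)⁻¹) (by simp [h])
    have h2 := wordNorm_mul_le inv_mem_T closure_T_eq_top (g * (t P)⁻¹) (t P)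
    rw [inv_mul_cancel_right] at h2
    have := wordNorm_le_one (t_mem_T (P := P))
    omega

/-- A family `h` is a product of a conjugate of `t` and a conjugate of `t⁻¹` as soon as some
ordered product of conjugates of its values is trivial. -/
theorem wordNorm_inl_le_two {h : HZ P} {c : ℤ → P} (hc : ∀ j, IsConj (h.1 j) (c j))
    (hcob : IsCoboundary c) : wordNorm (T P) (inl h) ≤ 2 := by
  have hf : ∀ j, ∃ x : P, c j = x⁻¹ * h.1 j * x ∧ (h.1 j = 1 → x = 1) := fun j => by
    by_cases hj : h.1 j = 1
    · refine ⟨1, ?_, fun _ => rfl⟩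
      have := hc j
      rw [hj, isConj_one_right] at this
      simp [hj, this]
    · obtain ⟨x, hx⟩ := isConj_iff.mp (hc j)
      exact ⟨x⁻¹, by simpa using hx.symm, fun h => absurd h hj⟩
  choose f hf hf1 using hf
  have hfZ : f ∈ HZ P := h.2.subset fun j hj hj' => hj (hf1 j hj')
  obtain ⟨W, hW, hWc⟩ := hcob
  have hcommW : ∀ j, W (j + 1) * (W j)⁻¹ = (f j)⁻¹ * h.1 j * f j := fun j => by
    rw [hWc, mul_inv_cancel_right, hf]
  set F : HZ P := ⟨f, hfZ⟩
  set E : HZ P := F * ⟨W, hW⟩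
  have key : (inl h : GZ P) = inl F * t P * (inl F)⁻¹ * (inl E * (t P)⁻¹ * (inl E)⁻¹) := by
    refine GZ.ext' (fun i => ?_) (by simp)
    have e1 : ∀ j, (inl F : GZ P).left.1 j = f j := fun _ => rfl
    have e2 : ∀ j, (inl E : GZ P).left.1 j = f j * W j := fun _ => rfl
    simp only [mul_left_apply, inv_left_apply, inv_right, e1, e2, mul_right, right_inl, t_right,
      t_left]
    have e : h.1 i = f i * (W (i + 1) * (W i)⁻¹) * (f i)⁻¹ := by rw [hcommW]; group
    simp [e, mul_assoc]
  have h2 := wordNorm_mul_le inv_mem_T closure_T_eq_top (inl F * t P * (inl F)⁻¹)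
    (inl E * (t P)⁻¹ * (inl E)⁻¹)
  rw [← key] at h2
  have := wordNorm_le_one (conj_mem_T _ (t_mem_T (P := P)) (inl F))
  have := wordNorm_le_one (conj_mem_T _ (inv_mem_T _ (t_mem_T (P := P))) (inl E))
  omega

/-- A family with four or more nontrivial values has norm at most two, by (S3). -/
theorem wordNorm_inl_le_three (hS : SatisfiesS P) (h : HZ P) :
    wordNorm (T P) (inl h) ≤ 3 := by
  classical
  obtain ⟨M, hM⟩ := exists_window h.2
  rcases Nat.lt_or_ge (Nat.count (fun i : ℕ => h.1 (-M + i) ≠ 1) (2 * M)) 4 with hlt | hge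
  · rw [Nat.count_eq_card_filter_range] at hlt
    refine (wordNorm_inl_le_card (s := ((Finset.range (2 * M)).filter
      fun i : ℕ => h.1 (-M + i) ≠ 1).image fun i : ℕ => -M + (i : ℤ)) fun j hj => ?_).trans
      (Finset.card_image_le.trans (Nat.le_of_lt_succ hlt))
    by_contra hne
    refine hj (Finset.mem_image.mpr ⟨(j + M).toNat, ?_⟩)
    have hj' : ¬ (j < -M ∨ (M : ℤ) ≤ j) := fun h' => hne (hM j h')
    have e : -(M : ℤ) + ((j + M).toNat : ℤ) = j := by omega
    rw [Finset.mem_filter, Finset.mem_range, e]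
    exact ⟨⟨by omega, hne⟩, rfl⟩
  · obtain ⟨c, hc, hp⟩ := (hS.conjProducts_count h.1 (-M) (2 * M)).2.2.2.2 hge
    refine (wordNorm_inl_le_two hc (isCoboundary_of_seqProd (fun j hj => ?_) hp)).trans (by norm_num)
    have := hc j
    rwa [hM j (by push_cast at hj; omega), isConj_one_right] at this

end Upper

/-! ### The finite cyclic wreath products -/

section Cyclic

open SemidirectProduct

variable {P : Type*} [Group P] {n : ℕ}

/-- Translation of the index by elements of `ZMod n`, acting on families indexed by `ZMod n`. -/
def cyclicShiftHom (P : Type*) [Group P] (n : ℕ) :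
    Multiplicative (ZMod n) →* MulAut (ZMod n → P) where
  toFun k :=
    { toFun := fun f i => f (i + k.toAdd)
      invFun := fun f i => f (i - k.toAdd)
      left_inv := fun f => by simp
      right_inv := fun f => by simp
      map_mul' := fun _ _ => rfl }
  map_one' := by ext f i; simp
  map_mul' k l := by
    ext f i
    simp [add_assoc]

/-- The wreath product of `P` with the cyclic group of order `n`. -/
abbrev CyclicWreath (P : Type*) [Group P] (n : ℕ) : Type _ :=
  SemidirectProduct (ZMod n → P) (Multiplicative (ZMod n)) (cyclicShiftHom P n)

namespace CyclicWreath

instance [Finite P] [NeZero n] : Finite (CyclicWreath P n) :=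
  Finite.of_injective (fun g => (g.left, g.right.toAdd)) fun _ _ h =>
    SemidirectProduct.ext (congrArg Prod.fst h) (congrArg Prod.snd h)

theorem mul_left_apply (g g' : CyclicWreath P n) (i : ZMod n) :
    (g * g').left i = g.left i * g'.left (i + g.right.toAdd) := rfl

theorem inv_left_apply (g : CyclicWreath P n) (i : ZMod n) :
    (g⁻¹).left i = (g.left (i - g.right.toAdd))⁻¹ := by
  rw [sub_eq_add_neg]
  rfl

theorem ext' {g g' : CyclicWreath P n} (h : ∀ i, g.left i = g'.left i)
    (h' : g.right.toAdd = g'.right.toAdd) : g = g' :=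
  SemidirectProduct.ext (funext h) h'

/-- The generator of the cyclic factor. -/
def t (P : Type*) [Group P] (n : ℕ) : CyclicWreath P n := inr (Multiplicative.ofAdd 1)

/-- The copy of `P` at index `0`, together with the generator of the cyclic factor and its
inverse. -/
def S (P : Type*) [Group P] (n : ℕ) : Set (CyclicWreath P n) :=
  Set.range (fun p : P => inl (Pi.mulSingle 0 p)) ∪ {t P n, (t P n)⁻¹}

/-- The smallest conjugation-invariant set containing `S`. -/
abbrev T (P : Type*) [Group P] (n : ℕ) : Set (CyclicWreath P n) := Group.conjugatesOfSet (S P n)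

theorem t_zpow (k : ℤ) : (t P n) ^ k = inr (Multiplicative.ofAdd (k : ZMod n)) := by
  rw [t, ← map_zpow, ← ofAdd_zsmul, zsmul_one]

theorem inv_mem_T : ∀ s ∈ T P n, s⁻¹ ∈ T P n := by
  refine inv_mem_conjugatesOfSet ?_
  rintro s (⟨p, rfl⟩ | rfl | rfl)
  · exact Or.inl ⟨p⁻¹, by simp only [Pi.mulSingle_inv, map_inv]⟩
  · exact Or.inr (Or.inr rfl)
  · exact Or.inr (Or.inl (inv_inv _))

theorem conj_mem_T : ∀ s ∈ T P n, ∀ c : CyclicWreath P n, c * s * c⁻¹ ∈ T P n :=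
  fun _ hs _ => Group.conj_mem_conjugatesOfSet hs

theorem closure_T_eq_top [NeZero n] : Subgroup.closure (T P n) = ⊤ := by
  refine (Subgroup.eq_top_iff' _).mpr fun g => ?_
  have hSt : t P n ∈ S P n := Or.inr (Or.inl rfl)
  have ht : t P n ^ g.right.toAdd.valMinAbs ∈ Subgroup.closure (T P n) :=
    zpow_mem (Subgroup.subset_closure (Group.subset_conjugatesOfSet hSt)) _
  rw [t_zpow, ZMod.coe_valMinAbs] at ht
  rw [← inl_left_mul_inr_right g]
  refine mul_mem ?_ ht
  obtain ⟨l, -, hl⟩ := exists_list_prod_mulSingle Finset.univ g.left (by simp)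
  rw [← hl, map_list_prod, List.map_map]
  refine list_prod_mem fun x hx => Subgroup.subset_closure ?_
  obtain ⟨y, -, rfl⟩ := List.mem_map.mp hx
  have e : (inl (Pi.mulSingle y.1 y.2) : CyclicWreath P n) =
      inr (Multiplicative.ofAdd (-y.1)) * inl (Pi.mulSingle 0 y.2) *
        (inr (Multiplicative.ofAdd (-y.1)))⁻¹ := by
    refine ext' (fun i => ?_) (by simp)
    simp only [mul_left_apply, inv_left_apply, left_inl, left_inr, right_inr]
    simp [Pi.mulSingle_apply, ← sub_eq_add_neg, sub_eq_zero]
  rw [Function.comp_apply, e]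
  exact conj_mem_T _ (Group.subset_conjugatesOfSet (Or.inl ⟨_, rfl⟩)) _

/-- The three kinds of elements of `T`: conjugates of elements of `P`, of `t`, and of `t⁻¹`. -/
theorem mem_T_cases {g : CyclicWreath P n} (hg : g ∈ T P n) :
    (g.right.toAdd = 0 ∧ ∃ a, ∀ i, i ≠ a → g.left i = 1) ∨
    (g.right.toAdd = 1 ∧ ∃ f : ZMod n → P, ∀ i, g.left i = f i * (f (i + 1))⁻¹) ∨
    (g.right.toAdd = -1 ∧ ∃ f : ZMod n → P, ∀ i, g.left i = f i * (f (i - 1))⁻¹) := by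
  obtain ⟨s, hs, c, rfl⟩ := by simpa only [Group.mem_conjugatesOfSet_iff, isConj_iff] using hg
  have hval : ∀ i, (c * s * c⁻¹).left i =
      c.left i * s.left (i + c.right.toAdd) * (c.left (i + s.right.toAdd))⁻¹ := fun i => by
    simp only [mul_left_apply, inv_left_apply, mul_right, toAdd_mul]
    rw [show i + (c.right.toAdd + s.right.toAdd) - c.right.toAdd = i + s.right.toAdd by ring]
  have hright : (c * s * c⁻¹).right.toAdd = s.right.toAdd := by
    simp [mul_right, inv_right]
  simp only [hval, hright]
  rcases hs with ⟨p, rfl⟩ | rfl | rfl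
  · refine Or.inl ⟨rfl, -c.right.toAdd, fun i hi => ?_⟩
    have : i + c.right.toAdd ≠ 0 := fun h => hi (eq_neg_of_add_eq_zero_left h)
    simp [this]
  · exact Or.inr (Or.inl ⟨rfl, c.left, fun i => by simp [t]⟩)
  · exact Or.inr (Or.inr ⟨rfl, c.left, fun i => by simp [t, inv_left_apply, sub_eq_add_neg]⟩)

theorem exists_right_prod_eq {w : List (CyclicWreath P n)} (hw : ∀ s ∈ w, s ∈ T P n) :
    ∃ j : ℤ, j.natAbs ≤ w.length ∧ w.prod.right.toAdd = (j : ZMod n) := by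
  induction w with
  | nil => exact ⟨0, by simp⟩
  | cons s w ih =>
    obtain ⟨j, hj, e⟩ := ih fun r hr => hw r (List.mem_cons_of_mem _ hr)
    have hs : ∃ i : ℤ, i.natAbs ≤ 1 ∧ s.right.toAdd = (i : ZMod n) := by
      rcases mem_T_cases (hw s List.mem_cons_self) with h | h | h
      exacts [⟨0, by simp [h.1]⟩, ⟨1, by simp [h.1]⟩, ⟨-1, by simp [h.1]⟩]
    obtain ⟨i, hi, e'⟩ := hs
    refine ⟨i + j, ?_, by simp [e, e']⟩
    rw [List.length_cons]
    omega

end CyclicWreath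

theorem ZMod_intCast_eq_iff_of_lt {a b : ℤ} (h : (a - b).natAbs < n) :
    (a : ZMod n) = b ↔ a = b := by
  refine ⟨fun e => ?_, fun e => by rw [e]⟩
  have := Int.eq_zero_of_abs_lt_dvd ((ZMod.intCast_zmod_eq_zero_iff_dvd (a - b) n).mp
    (by rw [Int.cast_sub, e, sub_self])) (by rw [Int.abs_eq_natAbs]; exact_mod_cast h)
  omega

theorem CyclicWreath.natAbs_le_wordNorm [NeZero n] {g : CyclicWreath P n} {k : ℤ}
    (hk : g.right.toAdd = (k : ZMod n)) (hn : 2 * k.natAbs < n) :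
    k.natAbs ≤ wordNorm (T P n) g := by
  obtain ⟨w, hw, hwT, rfl⟩ := exists_word_length_eq_wordNorm inv_mem_T closure_T_eq_top g
  obtain ⟨j, hj, e⟩ := exists_right_prod_eq hwT
  by_contra! hlt
  have := (ZMod_intCast_eq_iff_of_lt (n := n) (a := k) (b := j) (by omega)).mp (hk.symm.trans e)
  omega

theorem valMinAbs_intCast {y : ℤ} (h1 : -(n : ℤ) < 2 * y) (h2 : 2 * y ≤ n) :
    (y : ZMod n).valMinAbs = y := by
  have : NeZero n := ⟨by omega⟩
  exact (ZMod.valMinAbs_spec _ _).mpr ⟨rfl, by constructor <;> omega⟩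

/-- A solution of the coboundary equation on `ZMod n` yields one on `ℤ`: going around the
complement of the support shows that the ordered product of the values of `c` is trivial. -/
theorem isCoboundary_of_cyclic {c : ℤ → P} {M : ℕ} (hc : ∀ j : ℤ, (j < -M ∨ (M : ℤ) ≤ j) → c j = 1)
    (hn : 2 * M < n) {W : ZMod n → P} (hW : ∀ i, W (i + 1) = c i.valMinAbs * W i) :
    IsCoboundary c := by
  have : NeZero n := ⟨by omega⟩
  have h1 : ∀ m : ℕ, m ≤ 2 * M →
      W ((-M + m : ℤ) : ZMod n) = seqProd c (-M) m * W ((-M : ℤ) : ZMod n) := by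
    intro m hm
    induction m with
    | zero => simp [seqProd]
    | succ m ih =>
      rw [seqProd_succ, mul_assoc, ← ih (by omega), Nat.cast_succ, ← add_assoc, Int.cast_add,
        Int.cast_one, hW, valMinAbs_intCast (by omega) (by omega)]
  have h2 : ∀ r : ℕ, r ≤ n - 2 * M → W ((M + r : ℤ) : ZMod n) = W ((M : ℤ) : ZMod n) := by
    intro r hr
    induction r with
    | zero => simp
    | succ r ih =>
      rw [Nat.cast_succ, ← add_assoc, Int.cast_add, Int.cast_one, hW, ih (by omega), hc, one_mul]
      by_contra! hcon
      set v := ((M + r : ℤ) : ZMod n).valMinAbs with hv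
      have e : ((M + r : ℤ) : ZMod n) = (v : ZMod n) := (ZMod.coe_valMinAbs _).symm
      have := (ZMod_intCast_eq_iff_of_lt (by omega)).mp e
      omega
  have h3 : ((M + (n - 2 * M : ℕ) : ℤ) : ZMod n) = ((-M : ℤ) : ZMod n) := by
    rw [show (M + (n - 2 * M : ℕ) : ℤ) = n + -M by omega]
    simp
  have e1 := h1 (2 * M) le_rfl
  have e2 := h2 (n - 2 * M) le_rfl
  rw [show (-M + (2 * M : ℕ) : ℤ) = M by push_cast; ring] at e1
  rw [h3, e1] at e2
  refine isCoboundary_of_seqProd (a := -M) (N := 2 * M) (fun j hj => hc j ?_)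
    (mul_eq_right.mp e2.symm)
  push_cast at hj
  omega

end Cyclic

/-! ### Approximation by cyclic wreath products -/

section Approximation

open SemidirectProduct Filter

variable {P : Type*} [Group P]

/-- The map from `GZ P` to the cyclic wreath product of order `n` which reads off a family on `ℤ`
at the representatives of absolute value at most `n / 2`. It is not a homomorphism. -/
noncomputable def wrap (n : ℕ) (g : GZ P) : CyclicWreath P n :=
  ⟨fun i => g.left.1 i.valMinAbs, Multiplicative.ofAdd ((g.right.toAdd : ℤ) : ZMod n)⟩

theorem wrap_left (n : ℕ) (g : GZ P) (i : ZMod n) : (wrap n g).left i = g.left.1 i.valMinAbs := rfl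

theorem wrap_right (n : ℕ) (g : GZ P) :
    (wrap n g).right.toAdd = ((g.right.toAdd : ℤ) : ZMod n) := rfl

theorem wrap_one (n : ℕ) : wrap n (1 : GZ P) = 1 :=
  CyclicWreath.ext' (fun _ => rfl) (by simp [wrap_right])

/-- For large `n`, translation by `k` commutes with taking representatives as far as a finitely
supported family can tell. -/
theorem eventually_apply_valMinAbs_add {h : ℤ → P} (hh : h ∈ HZ P) (k : ℤ) :
    ∀ᶠ n : ℕ in atTop, ∀ i : ZMod n, h (i.valMinAbs + k) = h (i + k).valMinAbs := by
  obtain ⟨M, hM⟩ := exists_window hh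
  filter_upwards [eventually_gt_atTop (2 * (M + k.natAbs))] with n hn i
  by_cases h1 : i.valMinAbs + k < -M ∨ M ≤ i.valMinAbs + k
  · by_cases h2 : (i + k).valMinAbs < -M ∨ M ≤ (i + k).valMinAbs
    · rw [hM _ h1, hM _ h2]
    · have e := valMinAbs_intCast (n := n) (y := (i + k).valMinAbs - k) (by omega) (by omega)
      rw [Int.cast_sub, ZMod.coe_valMinAbs, add_sub_cancel_right] at e
      rw [e, sub_add_cancel]
  · have e := valMinAbs_intCast (n := n) (y := i.valMinAbs + k) (by omega) (by omega)
    rw [Int.cast_add, ZMod.coe_valMinAbs] at e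
    rw [e]

theorem eventually_wrap_mul (g g' : GZ P) :
    ∀ᶠ n : ℕ in atTop, wrap n (g * g') = wrap n g * wrap n g' := by
  filter_upwards [eventually_apply_valMinAbs_add g'.left.2 g.right.toAdd] with n hn
  refine CyclicWreath.ext' (fun i => ?_) (by simp [wrap_right])
  rw [wrap_left, mul_left_apply, CyclicWreath.mul_left_apply, wrap_left, wrap_left, wrap_right, hn]

theorem eventually_wrap_inv (g : GZ P) : ∀ᶠ n : ℕ in atTop, wrap n g⁻¹ = (wrap n g)⁻¹ := by
  filter_upwards [eventually_wrap_mul g⁻¹ g] with n hn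
  rw [inv_mul_cancel, wrap_one] at hn
  exact eq_inv_of_mul_eq_one_left hn.symm

theorem eventually_wrap_ne {g g' : GZ P} (hne : g ≠ g') :
    ∀ᶠ n : ℕ in atTop, wrap n g ≠ wrap n g' := by
  by_cases hl : ∃ j, g.left.1 j ≠ g'.left.1 j
  · obtain ⟨j, hj⟩ := hl
    filter_upwards [eventually_gt_atTop (2 * j.natAbs)] with n hn h
    have := congrArg (fun x => x.left (j : ZMod n)) h
    simp only [wrap_left, valMinAbs_intCast (n := n) (y := j) (by omega) (by omega)] at this
    exact hj this
  · push Not at hl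
    filter_upwards [eventually_gt_atTop (g.right.toAdd - g'.right.toAdd).natAbs] with n hn h
    exact hne (GZ.ext' hl ((ZMod_intCast_eq_iff_of_lt hn).mp
      (congrArg (fun x => x.right.toAdd) h)))

theorem wrap_mem_S {g : GZ P} (hg : g ∈ S P) (n : ℕ) : wrap n g ∈ CyclicWreath.S P n := by
  rcases hg with ⟨h, hh, rfl⟩ | rfl | rfl
  · refine Or.inl ⟨h.1 0, CyclicWreath.ext' (fun i => ?_) (by simp [wrap_right])⟩
    rw [wrap_left, left_inl, left_inl, Pi.mulSingle_apply]
    split_ifs with hi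
    · simp [hi]
    · exact (hh _ (by simpa using hi)).symm
  · exact Or.inr (Or.inl (CyclicWreath.ext' (fun i => rfl) (by simp [wrap_right, CyclicWreath.t])))
  · refine Or.inr (Or.inr (CyclicWreath.ext' (fun i => ?_) (by simp [wrap_right, CyclicWreath.t])))
    rw [wrap_left, inv_left_apply, CyclicWreath.inv_left_apply]
    rfl

theorem eventually_wrap_mem_T {g : GZ P} (hg : g ∈ T P) :
    ∀ᶠ n : ℕ in atTop, wrap n g ∈ CyclicWreath.T P n := by
  obtain ⟨s, hs, c, rfl⟩ := by simpa only [Group.mem_conjugatesOfSet_iff, isConj_iff] using hg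
  filter_upwards [eventually_wrap_mul (c * s) c⁻¹, eventually_wrap_mul c s, eventually_wrap_inv c]
    with n h1 h2 h3
  rw [h1, h2, h3]
  exact CyclicWreath.conj_mem_T _ (Group.subset_conjugatesOfSet (wrap_mem_S hs n)) _

theorem eventually_wordNorm_wrap_prod_le {w : List (GZ P)} (hw : ∀ s ∈ w, s ∈ T P) :
    ∀ᶠ n : ℕ in atTop, wordNorm (CyclicWreath.T P n) (wrap n w.prod) ≤ w.length := by
  induction w with
  | nil => simp [wrap_one, wordNorm_one]
  | cons s w ih =>
    filter_upwards [ih fun r hr => hw r (List.mem_cons_of_mem _ hr),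
      eventually_wrap_mem_T (hw s List.mem_cons_self), eventually_wrap_mul s w.prod,
      eventually_gt_atTop 0] with n h1 h2 h3 h4
    have : NeZero n := ⟨h4.ne'⟩
    rw [List.prod_cons, h3, List.length_cons]
    have := wordNorm_mul_le CyclicWreath.inv_mem_T CyclicWreath.closure_T_eq_top
      (wrap n s) (wrap n w.prod)
    have := wordNorm_le_one h2
    omega

theorem eventually_wordNorm_wrap_le (g : GZ P) :
    ∀ᶠ n : ℕ in atTop, wordNorm (CyclicWreath.T P n) (wrap n g) ≤ wordNorm (T P) g := by
  obtain ⟨w, hw, hwT, rfl⟩ := exists_word_length_eq_wordNorm inv_mem_T closure_T_eq_top g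
  rw [← hw]
  exact eventually_wordNorm_wrap_prod_le hwT

theorem eventually_wordNorm_le_of_right_eq_one {g : GZ P} (h1 : g.right.toAdd = 1) :
    ∀ᶠ n : ℕ in atTop, wordNorm (T P) g ≤ wordNorm (CyclicWreath.T P n) (wrap n g) := by
  obtain ⟨M, hM⟩ := exists_window g.left.2
  filter_upwards [eventually_gt_atTop (2 * M + 2)] with n hn
  have : NeZero n := ⟨by omega⟩
  have hr : (wrap n g).right.toAdd = ((1 : ℤ) : ZMod n) := by rw [wrap_right, h1]
  have hge := CyclicWreath.natAbs_le_wordNorm hr (by simp; omega)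
  have hle := wordNorm_le_two_of_right_eq_one h1
  rcases Nat.eq_or_lt_of_le hge with heq | hlt
  · have hmem := mem_of_wordNorm_eq_one CyclicWreath.inv_mem_T CyclicWreath.closure_T_eq_top heq.symm
    rw [← heq]
    refine wordNorm_le_one (mem_T_of_isCoboundary h1 ?_)
    rcases CyclicWreath.mem_T_cases hmem with ⟨h, -⟩ | ⟨-, f, hf⟩ | ⟨h, -⟩
    · have := (ZMod_intCast_eq_iff_of_lt (n := n) (a := 1) (b := 0) (by simp; omega)).mp
        (by rw [← hr, h, Int.cast_zero])
      omega
    · refine isCoboundary_of_cyclic (M := M) (fun j hj => by simp [hM j hj]) (by omega)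
        (W := f) fun i => ?_
      rw [← wrap_left, hf]
      group
    · have := (ZMod_intCast_eq_iff_of_lt (n := n) (a := 1) (b := -1) (by simp; omega)).mp
        (by rw [← hr, h, Int.cast_neg, Int.cast_one])
      omega
  · exact hle.trans hlt

/-- In a cyclic wreath product, a product of a conjugate of `t` and a conjugate of `t⁻¹` satisfies
a conjugated coboundary equation, which lifts to `ℤ`. -/
theorem wordNorm_inl_le_two_of_cyclic {h : HZ P} {M n : ℕ}
    (hM : ∀ j : ℤ, (j < -M ∨ (M : ℤ) ≤ j) → h.1 j = 1) (hn : 2 * M < n) {e f : ZMod n → P}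
    (hef : ∀ i, h.1 i.valMinAbs = f i * (f (i + 1))⁻¹ * (e (i + 1) * (e i)⁻¹)) :
    wordNorm (T P) (inl h) ≤ 2 := by
  have hc : ∀ j : ℤ, IsConj (h.1 j) ((f j)⁻¹ * h.1 j * f j) := fun j =>
    isConj_iff.mpr ⟨(f j)⁻¹, by simp⟩
  refine wordNorm_inl_le_two hc (isCoboundary_of_cyclic (M := M) (fun j hj => by simp [hM j hj]) hn
    (W := fun i => (f i)⁻¹ * e i) fun i => ?_)
  rw [ZMod.coe_valMinAbs, hef]
  group

theorem eventually_wordNorm_inl_le (hS : SatisfiesS P) (h : HZ P) :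
    ∀ᶠ n : ℕ in atTop,
      wordNorm (T P) (inl h) ≤ wordNorm (CyclicWreath.T P n) (wrap n (inl h)) := by
  obtain ⟨M, hM⟩ := exists_window h.2
  have hne : ∀ᶠ n : ℕ in atTop, (inl h : GZ P) ≠ 1 → wrap n (inl h) ≠ 1 := by
    by_cases h1 : (inl h : GZ P) = 1
    · exact Eventually.of_forall fun n hn => absurd h1 hn
    · filter_upwards [eventually_wrap_ne h1] with n hn _
      rwa [wrap_one] at hn
  filter_upwards [eventually_gt_atTop (2 * M + 2), hne] with n hn hne
  have : NeZero n := ⟨by omega⟩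
  have hr : (wrap n (inl h)).right.toAdd = 0 := by simp [wrap_right]
  have hle := wordNorm_inl_le_three hS h
  have hZ : ∀ a b : ℤ, a.natAbs + b.natAbs ≤ 2 → (a : ZMod n) = b → a = b := fun a b hab =>
    (ZMod_intCast_eq_iff_of_lt (by omega)).mp
  have hsupp : ∀ s : Finset (ZMod n), (∀ i ∉ s, h.1 i.valMinAbs = 1) →
      wordNorm (T P) (inl h) ≤ s.card := fun s hs => by
    refine (wordNorm_inl_le_card (s := s.image ZMod.valMinAbs) fun j hj => ?_).trans
      Finset.card_image_le
    by_contra hj1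
    have hj' : ¬ (j < -M ∨ (M : ℤ) ≤ j) := fun h' => hj1 (hM j h')
    have e := valMinAbs_intCast (n := n) (y := j) (by omega) (by omega)
    refine hj (Finset.mem_image.mpr ⟨(j : ZMod n), ?_, e⟩)
    by_contra hjs
    exact hj1 (e ▸ hs _ hjs)
  set m := wordNorm (CyclicWreath.T P n) (wrap n (inl h)) with hm
  obtain h0 | h0 | h0 | h0 : m = 0 ∨ m = 1 ∨ m = 2 ∨ 3 ≤ m := by omega
  · have h1 : (inl h : GZ P) = 1 := by
      by_contra hcon
      exact hne hcon ((wordNorm_eq_zero_iff CyclicWreath.inv_mem_T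
        CyclicWreath.closure_T_eq_top _).mp (hm.symm.trans h0))
    rw [h1, wordNorm_one]
    exact Nat.zero_le _
  · have hmem := mem_of_wordNorm_eq_one CyclicWreath.inv_mem_T CyclicWreath.closure_T_eq_top
      (hm.symm.trans h0)
    rw [h0]
    rcases CyclicWreath.mem_T_cases hmem with ⟨-, a, ha⟩ | ⟨h1, -⟩ | ⟨h1, -⟩
    · simpa using hsupp {a} fun i hi => ha i (by simpa using hi)
    · have := hZ 0 1 (by simp) (by simpa using hr.symm.trans h1)
      omega
    · have := hZ 0 (-1) (by simp) (by simpa using hr.symm.trans h1)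
      omega
  · obtain ⟨x, hx, y, hy, hxy⟩ := exists_mul_of_wordNorm_eq_two CyclicWreath.inv_mem_T
      CyclicWreath.closure_T_eq_top (hm.symm.trans h0)
    rw [h0]
    have hsum : x.right.toAdd + y.right.toAdd = 0 := by
      rw [← hr, hxy]
      rfl
    have hval : ∀ i, h.1 i.valMinAbs = x.left i * y.left (i + x.right.toAdd) := fun i => by
      rw [← CyclicWreath.mul_left_apply, ← hxy]
      rfl
    rcases CyclicWreath.mem_T_cases hx with ⟨hx0, a, ha⟩ | ⟨hx0, f, hf⟩ | ⟨hx0, f, hf⟩ <;>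
    rcases CyclicWreath.mem_T_cases hy with ⟨hy0, b, hb⟩ | ⟨hy0, e, he⟩ | ⟨hy0, e, he⟩ <;>
    rw [hx0, hy0] at hsum <;> rw [hx0] at hval
    · refine (hsupp {a, b} fun i hi => ?_).trans Finset.card_le_two
      simp only [Finset.mem_insert, Finset.mem_singleton, not_or] at hi
      rw [hval, add_zero, ha i hi.1, hb i hi.2, one_mul]
    · have := hZ 1 0 (by simp) (by simpa using hsum)
      omega
    · have := hZ (-1) 0 (by simp) (by simpa using hsum)
      omega
    · have := hZ 1 0 (by simp) (by simpa using hsum)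
      omega
    · have := hZ 1 (-1) (by simp) (by
        simpa using eq_neg_of_add_eq_zero_left hsum)
      omega
    · refine wordNorm_inl_le_two_of_cyclic hM (by omega) (f := f) (e := e) fun i => ?_
      rw [hval, hf, he, add_sub_cancel_right]
    · have := hZ (-1) 0 (by simp) (by simpa using hsum)
      omega
    · -- Rewrite `x * y` as `y * (y⁻¹ * x * y)` to put the conjugate of `t` first.
      refine wordNorm_inl_le_two_of_cyclic hM (by omega) (f := e)
        (e := fun i => e i * (e (i - 1))⁻¹ * f (i - 1)) fun i => ?_
      rw [hval, hf, he, neg_add_cancel_right, add_sub_cancel_right, ← sub_eq_add_neg]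
      group
    · have := hZ (-1) 1 (by simp) (by
        simpa using eq_neg_of_add_eq_zero_left hsum)
      omega
  · exact hle.trans h0

end Approximation

/-! ### Metric local embeddability -/

section MetricLEF

open SemidirectProduct Filter

variable {P : Type*} [Group P]

theorem eventually_wordNorm_le_of_nonneg (hS : SatisfiesS P) {g : GZ P}
    (hg : 0 ≤ g.right.toAdd) :
    ∀ᶠ n : ℕ in atTop, wordNorm (T P) g ≤ wordNorm (CyclicWreath.T P n) (wrap n g) := by
  obtain h | h | h : g.right.toAdd = 0 ∨ g.right.toAdd = 1 ∨ 2 ≤ g.right.toAdd := by omega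
  · have : g = inl g.left := GZ.ext' (fun _ => rfl) h
    rw [this]
    exact eventually_wordNorm_inl_le hS g.left
  · exact eventually_wordNorm_le_of_right_eq_one h
  · have hle := wordNorm_le_of_two_le hS (g := g) (k := g.right.toAdd.natAbs) (by omega) (by omega)
    filter_upwards [eventually_gt_atTop (2 * g.right.toAdd.natAbs)] with n hn
    have : NeZero n := ⟨by omega⟩
    exact hle.trans (CyclicWreath.natAbs_le_wordNorm rfl hn)

theorem eventually_wordNorm_wrap_eq (hS : SatisfiesS P) (g : GZ P) :
    ∀ᶠ n : ℕ in atTop, wordNorm (CyclicWreath.T P n) (wrap n g) = wordNorm (T P) g := by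
  rcases le_total 0 g.right.toAdd with hg | hg
  · filter_upwards [eventually_wordNorm_wrap_le g, eventually_wordNorm_le_of_nonneg hS hg]
      with n h1 h2 using h1.antisymm h2
  · filter_upwards [eventually_wordNorm_wrap_le g,
      eventually_wordNorm_le_of_nonneg hS (g := g⁻¹) (by simpa using hg),
      eventually_wrap_inv g, eventually_gt_atTop 0] with n h1 h2 h3 h4
    have : NeZero n := ⟨h4.ne'⟩
    rw [h3, wordNorm_inv CyclicWreath.inv_mem_T CyclicWreath.closure_T_eq_top,
      wordNorm_inv inv_mem_T closure_T_eq_top] at h2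
    exact h1.antisymm h2

theorem IsInvariantPseudoNorm.comp {G H : Type*} [Group G] [Group H] {l : G → ℝ≥0}
    (hl : IsInvariantPseudoNorm l) (f : H →* G) : IsInvariantPseudoNorm fun x => l (f x) where
  map_one := by simp [hl.map_one]
  map_inv g := by simpa using hl.map_inv (f g)
  map_mul_le g h := by rw [map_mul]; exact hl.map_mul_le _ _
  map_conj g h := by simpa using hl.map_conj (f g) (f h)

theorem isMetricallyLEF_normZ [Finite P] (hS : SatisfiesS P) : IsMetricallyLEF (normZ P) := by
  refine ⟨isInvariantNorm_normZ.toIsInvariantPseudoNorm, fun D Q _ => ?_⟩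
  have hnorm : ∀ᶠ n : ℕ in atTop, ∀ g ∈ D,
      wordNorm (CyclicWreath.T P n) (wrap n g) = wordNorm (T P) g :=
    (Finset.eventually_all D).mpr fun g _ => eventually_wordNorm_wrap_eq hS g
  have hmul : ∀ᶠ n : ℕ in atTop, ∀ h ∈ D, ∀ g ∈ D, wrap n (h * g) = wrap n h * wrap n g :=
    (Finset.eventually_all D).mpr fun h _ =>
      (Finset.eventually_all D).mpr fun g _ => eventually_wrap_mul h g
  have hinj : ∀ᶠ n : ℕ in atTop, ∀ h ∈ D, ∀ g ∈ D, wrap n h = wrap n g → h = g :=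
    (Finset.eventually_all D).mpr fun h _ => (Finset.eventually_all D).mpr fun g _ => by
      rcases eq_or_ne h g with rfl | hne
      · exact Eventually.of_forall fun _ _ => rfl
      · filter_upwards [eventually_wrap_ne hne] with n hn e using absurd e hn
  obtain ⟨n, h1, h2, h3, h4⟩ :=
    (hnorm.and (hmul.and (hinj.and (eventually_gt_atTop 0)))).exists
  have : NeZero n := ⟨h4.ne'⟩
  -- `Shrink` only moves the finite group to the lowest universe.
  let e : Shrink.{0} (CyclicWreath P n) ≃* CyclicWreath P n := Shrink.mulEquiv
  have hval : ∀ g ∈ D, ((wordNorm (CyclicWreath.T P n) (e (e.symm (wrap n g))) : ℕ) : ℝ≥0) =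
      normZ P g := fun g hg => by
    rw [e.apply_symm_apply, h1 g hg]
    rfl
  refine ⟨Shrink.{0} (CyclicWreath P n), inferInstance,
    fun x => (wordNorm (CyclicWreath.T P n) (e x) : ℝ≥0),
    ⟨Finite.of_equiv _ e.symm.toEquiv, (isInvariantNorm_wordNorm CyclicWreath.inv_mem_T
      CyclicWreath.closure_T_eq_top
      CyclicWreath.conj_mem_T).toIsInvariantPseudoNorm.comp e.toMonoidHom⟩,
    fun g => e.symm (wrap n g), ?_, ?_, ?_, ?_, ?_⟩
  · exact fun h hh g hg he => h3 h hh g hg (e.symm.injective he)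
  · intro h hh g hg _
    rw [h2 h hh g hg, map_mul]
  all_goals
    intro g hg q _
    rw [hval g hg]

end MetricLEF

/-! ### Failure of residual finiteness -/

open SemidirectProduct in
/-- If `P` is not commutative, then `GZ P` is not residually finite: a subgroup of finite index
which is normal contains a power `t ^ k` with `k ≠ 0`, hence an element
`p * (t ^ k * p⁻¹ * t ^ (-k))` whose value at the index `0` is `p` and whose only other nontrivial
value is at `-k`, and thus the commutator of this element with any `q` at the index `0`. -/
theorem not_residuallyFinite_GZ {P : Type*} [Group P] {p q : P} (hpq : p * q ≠ q * p) :
    ¬ Group.ResiduallyFinite (GZ P) := by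
  intro hR
  have key := Group.residuallyFinite_iff_forall_finiteIndexNormalSubgroup.mp hR
    (inl (single 0 (p * q * p⁻¹ * q⁻¹))) fun N => ?_
  · have h0 := congrArg (fun g : GZ P => g.left.1 0) key
    simp only [left_inl, single_apply, if_true] at h0
    have h0' : p * q * p⁻¹ * q⁻¹ = 1 := h0
    exact hpq (by rwa [mul_inv_eq_one, mul_inv_eq_iff_eq_mul] at h0')
  · have hnormal : N.toSubgroup.Normal := inferInstance
    obtain ⟨k, hk, -, hkN⟩ := Subgroup.exists_pow_mem_of_index_ne_zero
      (H := N.toSubgroup) Subgroup.FiniteIndex.index_ne_zero (t P)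
    set a : GZ P := inl (single 0 p) with ha
    set b : GZ P := inl (single 0 q) with hb
    have h1 : a * (t P ^ k * a⁻¹ * (t P ^ k)⁻¹) ∈ N.toSubgroup := by
      have := N.toSubgroup.mul_mem (hnormal.conj_mem _ hkN a) (N.toSubgroup.inv_mem hkN)
      simpa [mul_assoc] using this
    set c : GZ P := a * (t P ^ k * a⁻¹ * (t P ^ k)⁻¹) with hc
    have h2 : c * (b * c⁻¹ * b⁻¹) ∈ N.toSubgroup :=
      N.toSubgroup.mul_mem h1 (hnormal.conj_mem _ (N.toSubgroup.inv_mem h1) b)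
    have e : (inl (single 0 (p * q * p⁻¹ * q⁻¹)) : GZ P) = c * (b * c⁻¹ * b⁻¹) := by
      have h3 : t P ^ k * a⁻¹ * (t P ^ k)⁻¹ = (inl (single (-k) p))⁻¹ := by
        rw [inl_single_eq_conj, neg_neg, zpow_natCast, ← ha]
        group
      rw [hc, h3, ha, hb]
      simp only [← map_inv, ← map_mul]
      refine congrArg _ (Subtype.ext (funext fun i => ?_))
      have hmul : ∀ x y : HZ P, (x * y).1 i = x.1 i * y.1 i := fun _ _ => rfl
      have hinv : ∀ x : HZ P, (x⁻¹).1 i = (x.1 i)⁻¹ := fun _ => rfl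
      simp only [hmul, hinv, single_apply]
      by_cases hi : i = 0
      · simp [hi, hk.ne', mul_assoc]
      · split_ifs <;> simp
    rw [e]
    exact h2

end MetricLEF

theorem theorem4 :
    (∀ (P : Type*) [Group P] [Finite P], MetricLEF.SatisfiesS P →
      Group.FG (MetricLEF.GZ P) ∧
      Subgroup.closure (MetricLEF.S P) = ⊤ ∧
      MetricLEF.IsInvariantNorm (MetricLEF.normZ P) ∧
      MetricLEF.IsMetricallyLEF (MetricLEF.normZ P)) ∧
    (Group.FG MetricLEF.G2 ∧
      ¬ Group.ResiduallyFinite MetricLEF.G2 ∧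
      Subgroup.closure (MetricLEF.S (alternatingGroup (Fin 5))) = ⊤ ∧
      MetricLEF.IsInvariantNorm (MetricLEF.normZ (alternatingGroup (Fin 5))) ∧
      MetricLEF.IsMetricallyLEF (MetricLEF.normZ (alternatingGroup (Fin 5)))) := by
  refine ⟨fun P _ _ hS => ⟨MetricLEF.fg_GZ, MetricLEF.closure_S_eq_top,
    MetricLEF.isInvariantNorm_normZ, MetricLEF.isMetricallyLEF_normZ hS⟩,
    MetricLEF.fg_GZ, ?_, MetricLEF.closure_S_eq_top, MetricLEF.isInvariantNorm_normZ,
    MetricLEF.isMetricallyLEF_normZ MetricLEF.satisfiesS_alternatingGroup_five⟩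
  obtain ⟨p, q, hpq⟩ : ∃ p q : alternatingGroup (Fin 5), p * q ≠ q * p := by
    by_contra! hcomm
    obtain ⟨u, -, -, hu, -⟩ := MetricLEF.satisfiesS_alternatingGroup_five.s4
    exact hu (MetricLEF.satisfiesS_alternatingGroup_five.eq_one_of_forall_commute (hcomm u))
  exact MetricLEF.not_residuallyFinite_GZ hpq
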